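/- Let \(F\) be a global field and \(E/F\) a (possibly infinite) Galois extension. For a field \(k\), a place of \(k\) is an equivalence class of nontrivial absolute values, and \(Y_k\) is the set of places of \(k\). For an intermediate field \(K\) of \(E/F\) with \(K/F\) finite Galois and \(v\in Y_K\), let \(Y(E/K,v)\) be the set of places of \(E\) dividing \(v\); these sets, for all such \(K\) and \(v\), are the basis of the topology on \(Y_E\). For \(y\in Y_E\) let \(E_y\) be the completion of \(E\) at \(y\), and, if \(y\) is non-Archimedean, \(\mathcal O_y=\{\alpha\in E_y:|\alpha|_y\le 1\}\). The group \(\mathrm{Gal}(E/F)\), with its Krull topology, acts on \(Y_E\) by \(|\sigma(\alpha)|_{\sigma(y)}=|\alpha|_y\), and \(\sigma\) extends by continuity to \(E_y\to E_{\sigma(y)}\). A \(v\)-adic transition diagram on \(E\) is a continuous map \(\lambda:Y(E/K,v)\times Y(E/K,v)\to\mathrm{Gal}(E/K)\) with \(\lambda(x,x)=1\), \(\lambda(x,y)(x)=y\) and \(\lambda(y,z)\lambda(x,y)=\lambda(x,z)\) for all \(x,y,z\); the set of these is \(T(E/K,v)\). For \(\lambda\in T(E/K,v)\), \(r\in Y(E/K,v)\)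 and \(U=\prod_{y\in Y_E}U_y\subseteq\prod_{y\in Y_E}E_y\) put \[J(K,\lambda,r;U)=\bigcup_{y\in Y(E/K,v)}\bigl(\{y\}\times\lambda(y,r)(U_y)\bigr).\] Let \(K,L\subseteq E\) be finite Galois over \(F\). For each \(v\in Y_K\) let \(\lambda_v\in T(E/K,v)\) and \(r_v\in Y(E/K,v)\); for each \(w\in Y_L\) let \(\mu_w\in T(E/L,w)\) and \(s_w\in Y(E/L,w)\). (1) For every family \(U=\prod_{y\in Y_E}U_y\subseteq\prod_{y\in Y_E}E_y\) the following are equivalent: (i) \(J(K,\lambda_v,r_v;U)\) is open in \(Y(E/K,v)\times E_{r_v}\) for all \(v\in Y_K\); (ii) \(J(L,\mu_w,s_w;U)\) is open in \(Y(E/L,w)\times E_{s_w}\) for all \(w\in Y_L\). (2) Let \(\mathbb A_E\) be the set of \((a_y)\in\prod_{y\in Y_E}E_y\) such that \(a_y\in\mathcal O_y\) for all \(y\) outside some compact subset of \(Y_E\), and such that \(y\mapsto\lambda_v(y,r_v)(a_y)\) is a continuous map \(Y(E/K,v)\to E_{r_v}\) for all \(v\in Y_K\). The basis of the topology on \(\mathbb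 A_E\) consists of the sets \(U\cap\mathbb A_E\), where \(U=\prod_{y\in Y_E} U_y\) satisfies \(U_y=\mathcal O_y\) for all \(y\) outside some compact subset of \(Y_E\), and satisfies (i). (The compact subsets are understood to contain all Archimedean places.) This collection of subsets of \(\prod_{y\in Y_E}E_y\) is the same when it is formed with \(L,\mu_w,s_w\) in place of \(K,\lambda_v,r_v\). -/

import Mathlib

noncomputable section

/-- A global field: a number field, or a function field in one variable over a finite field. -/
def IsGlobalField (F : Type*) [Field F] : Prop :=
  NumberField F ∨
    ∃ (k : Type) (_ : Field k) (_ : Finite k) (_ : Algebra (RatFunc k) F), FunctionField k F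

/-- Equivalence of nontrivial absolute values. -/
instance nontrivialAbsSetoid (k : Type*) [Field k] :
    Setoid {a : AbsoluteValue k ℝ // a.IsNontrivial} :=
  Setoid.comap Subtype.val inferInstance

/-- A place of a field: an equivalence class of nontrivial absolute values. -/
def Place (k : Type*) [Field k] : Type _ :=
  Quotient (nontrivialAbsSetoid k)

/-- The places of `E`. The field `F` is recorded because the topology, which is
generated by the sets of places dividing a given place of a finite Galois subextension of `E/F`,
and the Galois action refer to it. -/
def YPlace (F E : Type*) [Field F] [Field E] [Algebra F E] : Type _ := Place E

section

variable {F E : Type*} [Field F] [Field E] [Algebra F E]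

/-- An absolute value in the class `y`. -/
def YPlace.abv (y : YPlace F E) : AbsoluteValue E ℝ :=
  (Quotient.out (s := nontrivialAbsSetoid E) y).1

/-- The completion `E_y`. As a topological field it does not depend on the chosen absolute value
in the class `y`. -/
abbrev YPlace.Completion (y : YPlace F E) : Type _ := y.abv.Completion

/-- `y` is non-Archimedean. -/
def YPlace.IsNonarch (y : YPlace F E) : Prop := IsNonarchimedean (y.abv : E → ℝ)

/-- `O_y`, the closed unit ball of `E_y` (used only at non-Archimedean places). -/
def YPlace.integers (y : YPlace F E) : Set y.Completion := {a | ‖a‖ ≤ 1}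

/-- `y` divides `v`: some absolute value of `y` restricts to an absolute value of `v`. -/
def YPlace.Divides (y : YPlace F E) {K : IntermediateField F E} (v : Place K) : Prop :=
  ∃ (a : {a : AbsoluteValue E ℝ // a.IsNontrivial})
    (b : {b : AbsoluteValue K ℝ // b.IsNontrivial}),
    (Quotient.mk _ a : Place E) = y ∧ (Quotient.mk _ b : Place K) = v ∧
      ∀ x : K, a.1 (x : E) = b.1 x

/-- `Y(E/K,v)`, the set of places of `E` that divide the place `v` of `K`. -/
def placesAbove (K : IntermediateField F E) (v : Place K) : Set (YPlace F E) :=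
  {y | y.Divides v}

/-- The topology on the places of `E`, with the sets `Y(E/K,v)` as a basis, where `K/F` is finite
Galois. -/
instance : TopologicalSpace (YPlace F E) :=
  TopologicalSpace.generateFrom
    {S | ∃ K : IntermediateField F E, FiniteDimensional F K ∧ IsGalois F K ∧
      ∃ v : Place K, S = placesAbove K v}

/-- The conjugate `a ∘ σ⁻¹` of a nontrivial absolute value. -/
def conjAbs (σ : Gal(E/F)) (a : {a : AbsoluteValue E ℝ // a.IsNontrivial}) :
    {a : AbsoluteValue E ℝ // a.IsNontrivial} :=
  ⟨a.1.comp (f := (σ.symm : E →+* E)) σ.symm.injective, by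
    obtain ⟨x, hx, h⟩ := a.2
    refine ⟨σ x, by simpa using hx, ?_⟩
    change a.1 (σ.symm (σ x)) ≠ 1
    simpa using h⟩

theorem conjAbs_apply (σ : Gal(E/F)) (a : {a : AbsoluteValue E ℝ // a.IsNontrivial}) (x : E) :
    (conjAbs σ a).1 x = a.1 (σ.symm x) := rfl

/-- The action of `Gal(E/F)` on places, determined by `|σ α|_{σ y} = |α|_y`. -/
instance : MulAction Gal(E/F) (YPlace F E) where
  smul σ := Quotient.map (conjAbs σ) fun _ _ h x z ↦ h (σ.symm x) (σ.symm z)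
  one_smul y := by
    induction y using Quotient.inductionOn with
    | h a => rfl
  mul_smul σ τ y := by
    induction y using Quotient.inductionOn with
    | h a => rfl

/-- If `σ x = y` then `α ↦ |α|_x` and `α ↦ |σ α|_y` are equivalent. -/
theorem YPlace.abv_le_iff (σ : Gal(E/F)) {x y : YPlace F E} (h : σ • x = y) (α β : E) :
    x.abv α ≤ x.abv β ↔ y.abv (σ α) ≤ y.abv (σ β) := by
  have h1 : (Quotient.mk (nontrivialAbsSetoid E)
      (conjAbs σ (Quotient.out (s := nontrivialAbsSetoid E) x))) =
      Quotient.mk (nontrivialAbsSetoid E) (Quotient.out (s := nontrivialAbsSetoid E) y) := by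
    refine Eq.trans ?_ (Quotient.out_eq (s := nontrivialAbsSetoid E) y).symm
    rw [← h]
    conv_rhs => rw [← Quotient.out_eq (s := nontrivialAbsSetoid E) x]
    rfl
  have h2 := Quotient.exact h1 (σ α) (σ β)
  simp only [conjAbs_apply, AlgEquiv.symm_apply_apply] at h2
  exact h2

theorem YPlace.continuous_gal (σ : Gal(E/F)) {x y : YPlace F E} (h : σ • x = y) :
    Continuous (WithAbs.map x.abv y.abv (σ : E →+* E)) := by
  have he : x.abv.IsEquiv (y.abv.comp (f := (σ : E →+* E)) σ.injective) :=
    fun α β ↦ YPlace.abv_le_iff σ h α β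
  have h1 := he.isEmbedding_equivWithAbs.continuous
  have h2 : Isometry (WithAbs.map (y.abv.comp (f := (σ : E →+* E)) σ.injective) y.abv
      (σ : E →+* E)) := by
    refine AddMonoidHomClass.isometry_of_norm _ fun a ↦ ?_
    rfl
  exact h2.continuous.comp h1

/-- The map `E_x → E_y` extending `σ : E → E` by continuity, for `σ ∈ Gal(E/F)` with `σ x = y`. -/
def galMap (σ : Gal(E/F)) {x y : YPlace F E} (h : σ • x = y) : x.Completion →+* y.Completion :=
  UniformSpace.Completion.mapRingHom (WithAbs.map x.abv y.abv (σ : E →+* E))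
    (YPlace.continuous_gal σ h)

/-- A `v`-adic transition diagram on `E`. The group `Gal(E/K)` is the subgroup of `Gal(E/F)`
fixing `K` pointwise, with its Krull topology (the subspace topology from `Gal(E/F)`). -/
structure TransitionDiagram (K : IntermediateField F E) (v : Place K) where
  /-- The underlying map. -/
  gal : placesAbove K v → placesAbove K v → K.fixingSubgroup
  gal_self : ∀ x, gal x x = 1
  gal_smul : ∀ x y, (gal x y : Gal(E/F)) • (x : YPlace F E) = y
  gal_mul : ∀ x y z, gal y z * gal x y = gal x z
  continuous_gal : Continuous fun p : placesAbove K v × placesAbove K v ↦ gal p.1 p.2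

/-- The map `λ(x,y) : E_x → E_y`. -/
def TransitionDiagram.map {K : IntermediateField F E} {v : Place K} (l : TransitionDiagram K v)
    (x y : placesAbove K v) : x.1.Completion →+* y.1.Completion :=
  galMap (l.gal x y : Gal(E/F)) (l.gal_smul x y)

/-- `J(K,λ,r;U) = ⋃_y {y} × λ(y,r)(U_y)`, as a subset of `Y(E/K,v) × E_r`. -/
def JSet (K : IntermediateField F E) {v : Place K} (l : TransitionDiagram K v)
    (r : placesAbove K v) (U : ∀ y : YPlace F E, Set y.Completion) :
    Set (placesAbove K v × r.1.Completion) :=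
  ⋃ y : placesAbove K v, {y} ×ˢ (l.map y r '' U y.1)

/-- The set `𝔸_E` of adèles of `E`, as defined by means of `K`, `λ_v` and `r_v`. -/
def adeleSet (K : IntermediateField F E) (l : ∀ v : Place K, TransitionDiagram K v)
    (r : ∀ v : Place K, placesAbove K v) : Set (∀ y : YPlace F E, y.Completion) :=
  {a | (∃ Z : Set (YPlace F E), IsCompact Z ∧ ∀ y ∉ Z, y.IsNonarch ∧ a y ∈ y.integers) ∧
    ∀ v : Place K, Continuous fun y : placesAbove K v ↦ (l v).map y (r v) (a y.1)}

/-- The basis for the topology on `𝔸_E`, as defined by means of `K`, `λ_v` and `r_v`: the sets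
`U ∩ 𝔸_E` where `U = ∏ U_y` has `U_y = O_y` off a compact set (which contains the Archimedean
places) and all `J(K,λ_v,r_v;U)` are open. -/
def adeleBasis (K : IntermediateField F E) (l : ∀ v : Place K, TransitionDiagram K v)
    (r : ∀ v : Place K, placesAbove K v) : Set (Set (∀ y : YPlace F E, y.Completion)) :=
  {B | ∃ U : ∀ y : YPlace F E, Set y.Completion,
    (∃ Z : Set (YPlace F E), IsCompact Z ∧ ∀ y ∉ Z, y.IsNonarch ∧ U y = y.integers) ∧
    (∀ v : Place K, IsOpen (JSet K (l v) (r v) U)) ∧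
    B = Set.pi Set.univ U ∩ adeleSet K l r}

end

end

/-!
The decomposition-type sets `{σ ∈ Gal(E/F) | σ x = y}` act jointly continuously: the map
`(σ, b) ↦ σ(b)` from `{σ | σ x = y} × E_x` to `E_y` is continuous (`continuous_galMap`). Indeed `b`
is close to some `α ∈ E`, and `σ α` is locally constant in `σ`; the two remaining errors are
controlled by equicontinuity, which holds since `|z|_x < |t|_x ^ n` forces
`|σ z|_y ≤ |σ t|_y ^ n`, with `σ t` again locally constant, and `t` may be chosen with `|t|_x < 1`.

Let `y` lie over `v ∈ Y_K` and over `w ∈ Y_L`. Then `μ_w(y, s_w) = g(y) ∘ λ_v(y, r_v)` on `E_y`,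
where `g(y) = μ_w(y, s_w) λ_v(y, r_v)⁻¹` depends continuously on `y` and carries `r_v` to `s_w`.
By joint continuity, `(y, b) ↦ (y, g(y)(b))` is a homeomorphism from `W × E_{r_v}` to `W × E_{s_w}`,
where `W = Y(E/K,v) ∩ Y(E/L,w)`, and it carries the part of `J(K, λ_v, r_v; U)` over `W` to the
part of `J(L, μ_w, s_w; U)` over `W`. The sets `W` are open, and they cover `Y(E/L,w)` as `v` varies
because a nontrivial absolute value of `E` stays nontrivial on `K`, the extension `E/K` being
algebraic (`isNontrivial_comp_algebraMap`). Both openness of the sets `J` and continuity of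
`y ↦ λ_v(y, r_v)(a_y)` are therefore conditions that do not depend on the data chosen.
-/

noncomputable section

open Topology

/-! ### Restriction of places to subfields -/

/-- If `a` were trivial on `K`, it would be bounded on the finite-dimensional algebra `K[x]`, hence
on all powers of an `x` with `a x > 1`. -/
theorem isNontrivial_comp_algebraMap {K E : Type*} [Field K] [Field E] [Algebra K E]
    [Algebra.IsAlgebraic K E] {a : AbsoluteValue E ℝ} (ha : a.IsNontrivial) :
    (a.comp (f := algebraMap K E) (algebraMap K E).injective).IsNontrivial := by
  by_contra h
  rw [AbsoluteValue.not_isNontrivial_iff] at h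
  have hle (c : K) : a (algebraMap K E c) ≤ 1 := by
    rcases eq_or_ne c 0 with rfl | hc
    · simp
    · exact (h c hc).le
  obtain ⟨x, hx⟩ := ha.exists_abv_gt_one
  have hint : IsIntegral K x := (Algebra.IsAlgebraic.isAlgebraic x).isIntegral
  obtain ⟨m, hm⟩ := pow_unbounded_of_one_lt
    (∑ i ∈ Finset.range (minpoly K x).natDegree, a x ^ i) hx
  refine hm.not_ge ?_
  have hpow : x ^ m =
      Polynomial.aeval x ((Polynomial.X ^ m : Polynomial K) %ₘ minpoly K x) := by
    rw [Polynomial.aeval_modByMonic_eq_self_of_root (minpoly.aeval K x)]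
    simp
  rw [← map_pow, hpow, Polynomial.aeval_eq_sum_range'
    (Polynomial.natDegree_modByMonic_lt _ (minpoly.monic hint) (minpoly.ne_one K x))]
  refine (a.sum_le _ _).trans (Finset.sum_le_sum fun i _ ↦ ?_)
  rw [Algebra.smul_def, map_mul, map_pow]
  exact mul_le_of_le_one_left (by positivity) (hle _)

section

variable {F E : Type*} [Field F] [Field E] [Algebra F E]

theorem YPlace.isNontrivial_abv (y : YPlace F E) : y.abv.IsNontrivial :=
  (Quotient.out (s := nontrivialAbsSetoid E) y).2

/-- Every place of `E` divides some place of `K`. -/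
theorem exists_mem_placesAbove [Algebra.IsAlgebraic F E] (K : IntermediateField F E)
    (y : YPlace F E) : ∃ v : Place K, y ∈ placesAbove K v :=
  ⟨Quotient.mk _ ⟨_, isNontrivial_comp_algebraMap (K := K) y.isNontrivial_abv⟩,
    Quotient.out (s := nontrivialAbsSetoid E) y, _,
    Quotient.out_eq (s := nontrivialAbsSetoid E) y, rfl, fun _ ↦ rfl⟩

theorem isOpen_placesAbove (K : IntermediateField F E) [FiniteDimensional F K] [IsGalois F K]
    (v : Place K) : IsOpen (placesAbove K v) :=
  TopologicalSpace.isOpen_generateFrom_of_mem ⟨K, ‹_›, ‹_›, v, rfl⟩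

/-! ### Joint continuity of the Galois action on completions -/

theorem galMap_coe (σ : Gal(E/F)) {x y : YPlace F E} (h : σ • x = y) (α : E) :
    galMap σ h (WithAbs.toAbs x.abv α : x.Completion) =
      (WithAbs.toAbs y.abv (σ α) : y.Completion) :=
  UniformSpace.Completion.mapRingHom_coe _ _

theorem continuous_galMap_apply (σ : Gal(E/F)) {x y : YPlace F E} (h : σ • x = y) :
    Continuous (galMap σ h) :=
  UniformSpace.Completion.continuous_map

theorem galMap_galMap (σ τ ρ : Gal(E/F)) {x y z : YPlace F E} (h : σ • x = y) (h' : τ • y = z)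
    (hρ : ρ • x = z) (e : ρ = τ * σ) (b : x.Completion) :
    galMap τ h' (galMap σ h b) = galMap ρ hρ b := by
  subst e
  exact DFunLike.congr_fun (UniformSpace.Completion.mapRingHom_comp
    (YPlace.continuous_gal τ h') (YPlace.continuous_gal σ h)) b

/-- The extension of `σ` to completions sends the ball of radius `|t|_x` into the ball of radius
`|σ t|_y`. No comparison of the normalizations of the two absolute values is needed. -/
theorem norm_galMap_le (σ : Gal(E/F)) {x y : YPlace F E} (h : σ • x = y) (t : E)
    (b : x.Completion) (hb : ‖b‖ < x.abv t) : ‖galMap σ h b‖ ≤ y.abv (σ t) := by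
  suffices H : x.abv t ≤ ‖b‖ ∨ ‖galMap σ h b‖ ≤ y.abv (σ t) from H.resolve_left hb.not_ge
  clear hb
  induction b using UniformSpace.Completion.induction_on with
  | hp =>
    exact (isClosed_le continuous_const continuous_norm).union
      (isClosed_le (continuous_galMap_apply σ h).norm continuous_const)
  | ih b =>
    obtain ⟨α, rfl⟩ := WithAbs.toAbs_surjective _ b
    rw [galMap_coe, UniformSpace.Completion.norm_coe, UniformSpace.Completion.norm_coe,
      WithAbs.norm_toAbs_eq, WithAbs.norm_toAbs_eq]
    exact (le_total _ _).imp_right (YPlace.abv_le_iff σ h α t).1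

theorem isOpen_setOf_apply_eq [Algebra.IsIntegral F E] (σ₀ : Gal(E/F)) (t : E) :
    IsOpen {σ : Gal(E/F) | σ t = σ₀ t} := by
  have h := (stabilizer_isOpen_of_isIntegral (K := F) t).preimage (continuous_const_mul σ₀⁻¹)
  convert h using 1
  ext σ
  simp only [Set.mem_ofPred_eq, Set.mem_preimage, SetLike.mem_coe, MulAction.mem_stabilizer_iff,
    mul_smul, inv_smul_eq_iff]
  rfl

theorem continuous_galMap [Algebra.IsIntegral F E] (x y : YPlace F E) :
    Continuous fun p : {σ : Gal(E/F) // σ • x = y} × x.Completion ↦ galMap p.1.1 p.1.2 p.2 := by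
  rw [continuous_iff_continuousAt]
  rintro ⟨⟨σ₀, h₀⟩, b₀⟩
  rw [ContinuousAt, Metric.tendsto_nhds]
  intro ε hε
  obtain ⟨t, ht, ht1⟩ := x.isNontrivial_abv.exists_abv_lt_one
  have hs1 : y.abv (σ₀ t) < 1 := by
    rw [← not_le] at ht1 ⊢
    rwa [← map_one x.abv, YPlace.abv_le_iff σ₀ h₀, map_one σ₀, map_one] at ht1
  obtain ⟨n, hn⟩ := exists_pow_lt_of_lt_one (half_pos hε) hs1
  have hδ : 0 < x.abv (t ^ n) := x.abv.pos (pow_ne_zero n ht)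
  obtain ⟨β, hβ⟩ := UniformSpace.Completion.denseRange_coe.exists_dist_lt b₀ hδ
  obtain ⟨α, rfl⟩ := WithAbs.toAbs_surjective _ β
  have hσ : ∀ᶠ p : {σ : Gal(E/F) // σ • x = y} × x.Completion in 𝓝 (⟨σ₀, h₀⟩, b₀),
      p.1.1 t = σ₀ t ∧ p.1.1 α = σ₀ α :=
    (((isOpen_setOf_apply_eq σ₀ t).inter (isOpen_setOf_apply_eq σ₀ α)).preimage
      (continuous_subtype_val.comp continuous_fst)).mem_nhds ⟨rfl, rfl⟩
  have hb : ∀ᶠ p : {σ : Gal(E/F) // σ • x = y} × x.Completion in 𝓝 (⟨σ₀, h₀⟩, b₀),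
      dist p.2 (WithAbs.toAbs x.abv α : x.Completion) < x.abv (t ^ n) :=
    (isOpen_lt (continuous_snd.dist continuous_const) continuous_const).mem_nhds hβ
  have key (σ : Gal(E/F)) (h : σ • x = y) (hσt : σ t = σ₀ t) (hσα : σ α = σ₀ α)
      (b : x.Completion) (hb : dist b (WithAbs.toAbs x.abv α : x.Completion) < x.abv (t ^ n)) :
      dist (galMap σ h b) (WithAbs.toAbs y.abv (σ₀ α) : y.Completion) < ε / 2 := by
    rw [dist_eq_norm] at hb ⊢
    rw [← hσα, ← galMap_coe σ h, ← map_sub]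
    refine (norm_galMap_le σ h _ _ hb).trans_lt ?_
    rwa [map_pow, map_pow, hσt]
  filter_upwards [hσ, hb] with p hp hpb
  calc _ ≤ _ := dist_triangle_right _ _ (WithAbs.toAbs y.abv (σ₀ α) : y.Completion)
    _ < ε / 2 + ε / 2 := add_lt_add (key _ p.1.2 hp.1 hp.2 _ hpb) (key σ₀ h₀ rfl rfl _ hβ)
    _ = ε := add_halves ε

theorem continuous_galMap_comp [Algebra.IsIntegral F E] {X : Type*} [TopologicalSpace X]
    {x y : YPlace F E} {g : X → {σ : Gal(E/F) // σ • x = y}} {b : X → x.Completion}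
    (hg : Continuous g) (hb : Continuous b) :
    Continuous fun z ↦ galMap (g z).1 (g z).2 (b z) := by
  have h := (continuous_galMap x y).comp (hg.prodMk hb)
  exact h

/-! ### Comparison of two transition diagrams -/

variable {K L : IntermediateField F E} {v : Place K} {w : Place L}

/-- The element `m(y, s) l(y, r)⁻¹` of `Gal(E/F)`, which carries `r` to `s`, for a place `y` lying
over both `v` and `w`. -/
def comparison (l : TransitionDiagram K v) (m : TransitionDiagram L w)
    (r : placesAbove K v) (s : placesAbove L w)
    (y : (placesAbove K v ∩ placesAbove L w : Set (YPlace F E))) :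
    {σ : Gal(E/F) // σ • r.1 = s.1} :=
  ⟨m.gal ⟨y, y.2.2⟩ s * (l.gal ⟨y, y.2.1⟩ r : Gal(E/F))⁻¹, by
    rw [mul_smul, inv_smul_eq_iff.2 (l.gal_smul ⟨y, y.2.1⟩ r).symm, m.gal_smul ⟨y, y.2.2⟩ s]⟩

theorem continuous_comparison (l : TransitionDiagram K v) (m : TransitionDiagram L w)
    (r : placesAbove K v) (s : placesAbove L w) : Continuous (comparison l m r s) := by
  refine Continuous.subtype_mk (.mul ?_ (.inv ?_)) _
  · exact continuous_subtype_val.comp (m.continuous_gal.comp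
      ((continuous_inclusion Set.inter_subset_right).prodMk continuous_const))
  · exact continuous_subtype_val.comp (l.continuous_gal.comp
      ((continuous_inclusion Set.inter_subset_left).prodMk continuous_const))

theorem galMap_comparison (l : TransitionDiagram K v) (m : TransitionDiagram L w)
    (r : placesAbove K v) (s : placesAbove L w)
    (y : (placesAbove K v ∩ placesAbove L w : Set (YPlace F E))) (b : y.1.Completion) :
    galMap (comparison l m r s y).1 (comparison l m r s y).2 (l.map ⟨y, y.2.1⟩ r b) =
      m.map ⟨y, y.2.2⟩ s b :=
  galMap_galMap _ _ _ _ _ _ (by simp [comparison]) b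

theorem mem_JSet {l : TransitionDiagram K v} {r : placesAbove K v}
    {U : ∀ y : YPlace F E, Set y.Completion} {p : placesAbove K v × r.1.Completion} :
    p ∈ JSet K l r U ↔ ∃ a ∈ U p.1.1, l.map p.1 r a = p.2 := by
  obtain ⟨y, b⟩ := p
  simp only [JSet, Set.mem_iUnion, Set.mem_prod, Set.mem_singleton_iff, Set.mem_image]
  constructor
  · rintro ⟨_, rfl, h⟩
    exact h
  · exact fun h ↦ ⟨y, rfl, h⟩

/-- Over a place dividing both `v` and `w`, the comparison element identifies the fibres of the two
sets `J`. -/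
theorem galMap_comparison_mem_JSet (l : TransitionDiagram K v) (m : TransitionDiagram L w)
    (r : placesAbove K v) (s : placesAbove L w) (U : ∀ y : YPlace F E, Set y.Completion)
    (y : (placesAbove K v ∩ placesAbove L w : Set (YPlace F E))) (b : r.1.Completion) :
    (⟨y, y.2.2⟩, galMap (comparison l m r s y).1 (comparison l m r s y).2 b) ∈ JSet L m s U ↔
      (⟨y, y.2.1⟩, b) ∈ JSet K l r U := by
  simp only [mem_JSet, ← galMap_comparison l m r s y, (RingHom.injective _).eq_iff]

/-! ### Independence of the data -/

variable (K L) [FiniteDimensional F K] [IsGalois F K] [FiniteDimensional F L] [IsGalois F L]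

theorem isOpen_JSet_of_forall [Algebra.IsAlgebraic F E]
    (l : ∀ v : Place K, TransitionDiagram K v) (r : ∀ v : Place K, placesAbove K v)
    (m : ∀ w : Place L, TransitionDiagram L w) (s : ∀ w : Place L, placesAbove L w)
    {U : ∀ y : YPlace F E, Set y.Completion} (hU : ∀ v, IsOpen (JSet K (l v) (r v) U))
    (w : Place L) : IsOpen (JSet L (m w) (s w) U) := by
  rw [isOpen_iff_forall_mem_open]
  rintro ⟨y, b⟩ hp
  obtain ⟨v, hv⟩ := exists_mem_placesAbove K y.1
  let W : Set (YPlace F E) := placesAbove L w ∩ placesAbove K v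
  -- `f` is the open inclusion of the part over `W`, and `h` moves that part into `Y(E/K,v) × E_r`.
  let f : W × (s w).1.Completion → placesAbove L w × (s w).1.Completion :=
    Prod.map (Set.inclusion Set.inter_subset_left) id
  let h : W × (s w).1.Completion → placesAbove K v × (r v).1.Completion := fun p ↦
    (Set.inclusion Set.inter_subset_right p.1,
      galMap (comparison (m w) (l v) (s w) (r v) p.1).1
        (comparison (m w) (l v) (s w) (r v) p.1).2 p.2)
  have hh : Continuous h :=
    ((continuous_inclusion (Set.inter_subset_right : W ⊆ placesAbove K v)).comp
      continuous_fst).prodMk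
      (continuous_galMap_comp ((continuous_comparison (m w) (l v) (s w) (r v)).comp
        continuous_fst) continuous_snd)
  have hf : IsOpenMap f :=
    (((isOpen_placesAbove L w).inter (isOpen_placesAbove K v)).isOpenMap_inclusion _).prodMap
      IsOpenMap.id
  have hmem (p) : h p ∈ JSet K (l v) (r v) U ↔ f p ∈ JSet L (m w) (s w) U :=
    galMap_comparison_mem_JSet (m w) (l v) (s w) (r v) U p.1 p.2
  refine ⟨f '' (h ⁻¹' JSet K (l v) (r v) U), ?_, hf _ ((hU v).preimage hh),
    (⟨y.1, y.2, hv⟩, b), (hmem _).2 hp, rfl⟩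
  rintro _ ⟨p, hp, rfl⟩
  exact (hmem p).1 hp

theorem continuous_map_of_forall [Algebra.IsAlgebraic F E]
    (l : ∀ v : Place K, TransitionDiagram K v) (r : ∀ v : Place K, placesAbove K v)
    (m : ∀ w : Place L, TransitionDiagram L w) (s : ∀ w : Place L, placesAbove L w)
    {a : ∀ y : YPlace F E, y.Completion}
    (ha : ∀ v, Continuous fun y : placesAbove K v ↦ (l v).map y (r v) (a y.1)) (w : Place L) :
    Continuous fun y : placesAbove L w ↦ (m w).map y (s w) (a y.1) := by
  rw [continuous_iff_continuousAt]
  intro y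
  obtain ⟨v, hv⟩ := exists_mem_placesAbove K y.1
  let W : Set (YPlace F E) := placesAbove K v ∩ placesAbove L w
  have hi : IsOpenEmbedding (Set.inclusion Set.inter_subset_right : W → placesAbove L w) :=
    .of_continuous_injective_isOpenMap (continuous_inclusion _) (Set.inclusion_injective _)
      (((isOpen_placesAbove K v).inter (isOpen_placesAbove L w)).isOpenMap_inclusion _)
  have hc : Continuous fun z : W ↦
      (m w).map (Set.inclusion Set.inter_subset_right z) (s w) (a z.1) := by
    have := continuous_galMap_comp (continuous_comparison (l v) (m w) (r v) (s w))
      ((ha v).comp (continuous_inclusion (Set.inter_subset_left : W ⊆ placesAbove K v)))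
    exact this.congr fun z ↦ galMap_comparison (l v) (m w) (r v) (s w) z (a z.1)
  exact hi.continuousAt_iff (x := ⟨y.1, hv, y.2⟩) |>.1 hc.continuousAt

theorem adeleSet_subset [Algebra.IsAlgebraic F E]
    (l : ∀ v : Place K, TransitionDiagram K v) (r : ∀ v : Place K, placesAbove K v)
    (m : ∀ w : Place L, TransitionDiagram L w) (s : ∀ w : Place L, placesAbove L w) :
    adeleSet K l r ⊆ adeleSet L m s :=
  fun _ ha ↦ ⟨ha.1, continuous_map_of_forall K L l r m s ha.2⟩

theorem adeleBasis_subset [Algebra.IsAlgebraic F E]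
    (l : ∀ v : Place K, TransitionDiagram K v) (r : ∀ v : Place K, placesAbove K v)
    (m : ∀ w : Place L, TransitionDiagram L w) (s : ∀ w : Place L, placesAbove L w) :
    adeleBasis K l r ⊆ adeleBasis L m s := by
  rintro B ⟨U, hZ, hU, rfl⟩
  refine ⟨U, hZ, isOpen_JSet_of_forall K L l r m s hU, ?_⟩
  rw [(adeleSet_subset K L l r m s).antisymm (adeleSet_subset L K m s l r)]

end

end

theorem theorem6 {F E : Type*} [Field F] [Field E] [Algebra F E] (hF : IsGlobalField F)
    [IsGalois F E]
    (K L : IntermediateField F E)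
    [FiniteDimensional F K] [IsGalois F K] [FiniteDimensional F L] [IsGalois F L]
    (lam : ∀ v : Place K, TransitionDiagram K v) (r : ∀ v : Place K, placesAbove K v)
    (mu : ∀ w : Place L, TransitionDiagram L w) (s : ∀ w : Place L, placesAbove L w) :
    (∀ U : ∀ y : YPlace F E, Set y.Completion,
      (∀ v : Place K, IsOpen (JSet K (lam v) (r v) U)) ↔
        (∀ w : Place L, IsOpen (JSet L (mu w) (s w) U))) ∧
    adeleBasis K lam r = adeleBasis L mu s :=
  ⟨fun _ ↦ ⟨isOpen_JSet_of_forall K L lam r mu s, isOpen_JSet_of_forall L K mu s lam r⟩,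
    (adeleBasis_subset K L lam r mu s).antisymm (adeleBasis_subset L K mu s lam r)⟩
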